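/- **Theorem.** Let $T=[T_1,\dots,T_m]\in\mathbb R^{n\times m}$ be such that $T^\top$ has full row rank, let $b\in\mathbb R^m$ and $\ell,\mu,\rho>0$, and let $f:\mathbb R^n\to\mathbb R$ be continuously differentiable, convex and $\ell$-smooth in the sense that $$0\le(\nabla f(x)-\nabla f(x'))^\top(x-x')\le \ell\|x-x'\|^2\qquad\text{for all }x,x'\in\mathbb R^n .$$ Assume that $$(\nabla f(x)-\nabla f(x'))^\top(x-x')\ge\mu\|x-x'\|^2$$ holds for all $x,x'\in\ker(T^\top)$ and, for each $i=1,\dots,m$, for all $x,x'\in\{y\in\mathbb R^n: T_i^\top y<b_i\}$. Consider the problem $$\min_{x\in\mathbb R^n} f(x)\quad\text{subject to } T^\top x\le b \text{ (entrywise)}$$ and the augmented primal-dual gradient flow $$\dot x=-\nabla f(x)-\sum_{j=1}^m\max\{\rho(T_j^\top x-b_j)+\lambda_j,0\}\,T_j,\qquad \dot\lambda_j=\frac{\max\{\rho(T_j^\top x-b_j)+\lambda_j,0\}-\lambda_j}{\rho},\quad j=1,\dots,m .$$ Then the flow has a solution $(x(t),\lambda(t))$ on $[0,\infty)$ for every initial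 value in $\mathbb R^n\times\mathbb R^m$, the problem has a unique optimal solution $x^*$, and $x(t)$ converges to $x^*$ exponentially: there are $\lambda^*\in\mathbb R^m$ such that $(x^*,\lambda^*)$ is an equilibrium of the flow, and constants $C,\alpha>0$ not depending on the initial value, such that every solution $(x(t),\lambda(t))$ of the flow on $[0,\infty)$ satisfies $$\|x(t)-x^*\|\le C e^{-\alpha t}\sqrt{\|x(0)-x^*\|^2+\|\lambda(0)-\lambda^*\|^2}\qquad\text{for all }t\ge0 .$$ -/

import Mathlib

open scoped Matrix

noncomputable section

namespace AugPrimalDual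

/-- The `j`-th column `T_j` of `T`, as a vector of Euclidean space. -/
def column {n m : ℕ} (T : Matrix (Fin n) (Fin m) ℝ) (j : Fin m) : EuclideanSpace ℝ (Fin n) :=
  WithLp.toLp 2 (fun i => T i j)

/-- The feasible set `{x : Tᵀ x ≤ b}`, the inequality being entrywise. -/
def feasibleSet {n m : ℕ} (T : Matrix (Fin n) (Fin m) ℝ) (b : Fin m → ℝ) :
    Set (EuclideanSpace ℝ (Fin n)) :=
  {x | ∀ j, (Tᵀ *ᵥ x.ofLp) j ≤ b j}

/-- The kernel of `Tᵀ`. -/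
def kerTranspose {n m : ℕ} (T : Matrix (Fin n) (Fin m) ℝ) : Set (EuclideanSpace ℝ (Fin n)) :=
  {x | Tᵀ *ᵥ x.ofLp = 0}

/-- The open half-space `{y : T_jᵀ y < b_j}` on which the `j`-th constraint is inactive. -/
def inactiveHalfSpace {n m : ℕ} (T : Matrix (Fin n) (Fin m) ℝ) (b : Fin m → ℝ) (j : Fin m) :
    Set (EuclideanSpace ℝ (Fin n)) :=
  {y | (Tᵀ *ᵥ y.ofLp) j < b j}

/-- `x` is an optimal solution of `min f(x)` subject to `Tᵀ x ≤ b`. -/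
def IsOptimal {n m : ℕ} (f : EuclideanSpace ℝ (Fin n) → ℝ) (T : Matrix (Fin n) (Fin m) ℝ)
    (b : Fin m → ℝ) (x : EuclideanSpace ℝ (Fin n)) : Prop :=
  x ∈ feasibleSet T b ∧ ∀ y ∈ feasibleSet T b, f x ≤ f y

/-- `⟨∇f(x) - ∇f(x'), x - x'⟩ ≤ ℓ ‖x - x'‖²` for all `x, x'`. -/
def IsSmoothWith {n : ℕ} (l : ℝ) (f : EuclideanSpace ℝ (Fin n) → ℝ) : Prop :=
  ∀ x x' : EuclideanSpace ℝ (Fin n),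
    inner ℝ (gradient f x - gradient f x') (x - x') ≤ l * ‖x - x'‖ ^ 2

/-- `⟨∇f(x) - ∇f(x'), x - x'⟩ ≥ μ ‖x - x'‖²` for all `x, x'` in `S`. -/
def IsStronglyConvexIn {n : ℕ} (μ : ℝ) (f : EuclideanSpace ℝ (Fin n) → ℝ)
    (S : Set (EuclideanSpace ℝ (Fin n))) : Prop :=
  ∀ x ∈ S, ∀ x' ∈ S,
    μ * ‖x - x'‖ ^ 2 ≤ inner ℝ (gradient f x - gradient f x') (x - x')

/-- `max {ρ (T_jᵀ x - b_j) + λ_j, 0}`. -/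
def multiplier {n m : ℕ} (T : Matrix (Fin n) (Fin m) ℝ) (b : Fin m → ℝ) (ρ : ℝ)
    (x : EuclideanSpace ℝ (Fin n)) (lam : EuclideanSpace ℝ (Fin m)) (j : Fin m) : ℝ :=
  max (ρ * ((Tᵀ *ᵥ x.ofLp) j - b j) + lam j) 0

/-- Right-hand side of the `x`-equation of the augmented primal-dual gradient flow. -/
def primalField {n m : ℕ} (f : EuclideanSpace ℝ (Fin n) → ℝ) (T : Matrix (Fin n) (Fin m) ℝ)
    (b : Fin m → ℝ) (ρ : ℝ) (x : EuclideanSpace ℝ (Fin n)) (lam : EuclideanSpace ℝ (Fin m)) :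
    EuclideanSpace ℝ (Fin n) :=
  -gradient f x - ∑ j, multiplier T b ρ x lam j • column T j

/-- Right-hand side of the `λ`-equation of the augmented primal-dual gradient flow. -/
def dualField {n m : ℕ} (T : Matrix (Fin n) (Fin m) ℝ)
    (b : Fin m → ℝ) (ρ : ℝ) (x : EuclideanSpace ℝ (Fin n)) (lam : EuclideanSpace ℝ (Fin m)) :
    EuclideanSpace ℝ (Fin m) :=
  WithLp.toLp 2 (fun j => (multiplier T b ρ x lam j - lam j) / ρ)

/-- `(x, λ)` is an equilibrium point of the flow. -/
def IsEquilibrium {n m : ℕ} (f : EuclideanSpace ℝ (Fin n) → ℝ) (T : Matrix (Fin n) (Fin m) ℝ)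
    (b : Fin m → ℝ) (ρ : ℝ) (x : EuclideanSpace ℝ (Fin n)) (lam : EuclideanSpace ℝ (Fin m)) :
    Prop :=
  primalField f T b ρ x lam = 0 ∧ dualField T b ρ x lam = 0

/-- `(x(t), λ(t))` solves the augmented primal-dual gradient flow on `[0, ∞)`
(one-sided derivative at `t = 0`). -/
def IsFlowSolution {n m : ℕ} (f : EuclideanSpace ℝ (Fin n) → ℝ) (T : Matrix (Fin n) (Fin m) ℝ)
    (b : Fin m → ℝ) (ρ : ℝ) (x : ℝ → EuclideanSpace ℝ (Fin n))
    (lam : ℝ → EuclideanSpace ℝ (Fin m)) : Prop :=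
  ∀ t : ℝ, 0 ≤ t →
    HasDerivWithinAt x (primalField f T b ρ (x t) (lam t)) (Set.Ici 0) t ∧
    HasDerivWithinAt lam (dualField T b ρ (x t) (lam t)) (Set.Ici 0) t

end AugPrimalDual

end

/-!
Write `g` for the gradient of `f`, `A u = ∑ j, u j • T_j`, and `u` for the vector of multipliers
`max {ρ (T_jᵀ x - b_j) + λ_j, 0}`. The flow is `x' = -g x - A u`, `λ' = (u - λ) / ρ`.

*Convexity.* A convex function with the one-sided bound on the variation of its gradient satisfies
the Baillon–Haddad inequality `‖g x - g y‖² ≤ l ⟨g x - g y, x - y⟩`. In particular `g` is Lipschitz,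
so the field of the flow is globally Lipschitz and solutions exist for all times. Strong
monotonicity passes from an open half-space to its closure, hence holds on the feasible set; this
gives the unique minimizer `x*`, and linear independence of the columns gives multipliers `λ*`
satisfying the Karush–Kuhn–Tucker conditions, which say that `(x*, λ*)` is an equilibrium.

*Dissipation.* Put `ξ = x - x*`, `η = λ - λ*`, `G = g x - g x*`, `r = u - λ`. As `a ↦ max a 0` is
firmly nonexpansive (`multiplierVec_dissipation`), the energy `V = (‖ξ‖² + ‖η‖²) / 2` satisfies
`V' ≤ -⟨G, ξ⟩ - ‖r‖² / ρ`. This controls `‖ξ‖²` even where `f` is not strongly convex: since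
`r_j ≥ ρ (T_jᵀ x - b_j)`, the term in `r` bounds the distance from `x` to any one of the half-spaces,
and cocoercivity transfers strong monotonicity from the projection of `x` to `x` itself
(`exists_norm_sub_sq_le_of_halfSpace`).

*Exponential decay.* `V'` does not dissipate `η`. Since `u - λ* = η + r`, the derivative of
`⟨ξ, A η⟩` contains `-‖A η‖²`, its other terms being absorbed by the dissipation of `V`; as `A` is
injective, `W = K V + ⟨ξ, A η⟩` satisfies `W' ≤ -β W` for a large constant `K`
(`exists_exponential_decay`).
-/

/-! ### Smooth convex functions -/

section SmoothConvex

variable {E : Type*} [NormedAddCommGroup E] [InnerProductSpace ℝ E] [CompleteSpace E]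
  {f : E → ℝ} {g : E → E} {l μ : ℝ}

theorem HasGradientAt.hasDerivAt_comp_line {x d v : E} {t : ℝ}
    (h : HasGradientAt f v (x + t • d)) :
    HasDerivAt (fun s : ℝ => f (x + s • d)) (inner ℝ v d) t := by
  have h1 : HasDerivAt (fun s : ℝ => x + s • d) d t := by
    simpa using ((hasDerivAt_id t).smul_const d).const_add x
  have h2 := h.hasFDerivAt.comp_hasDerivAt t h1
  rwa [InnerProductSpace.toDual_apply_apply] at h2

theorem ConvexOn.add_inner_gradient_le (hconv : ConvexOn ℝ Set.univ f)
    (hg : ∀ x, HasGradientAt f (g x) x) (x y : E) :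
    f x + inner ℝ (g x) (y - x) ≤ f y := by
  have hc : ConvexOn ℝ Set.univ (fun s : ℝ => f (x + s • (y - x))) := by
    have := hconv.comp_affineMap (AffineMap.lineMap (k := ℝ) x y)
    refine this.congr fun s _ => ?_
    simp [AffineMap.lineMap_apply, add_comm]
  have hd : HasDerivAt (fun s : ℝ => f (x + s • (y - x))) (inner ℝ (g x) (y - x)) 0 :=
    HasGradientAt.hasDerivAt_comp_line (by simpa using hg x)
  have := hc.le_slope_of_hasDerivAt (Set.mem_univ 0) (Set.mem_univ 1) zero_lt_one hd
  simp [slope_def_field] at this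
  linarith

theorem ConvexOn.inner_gradient_sub_nonneg (hconv : ConvexOn ℝ Set.univ f)
    (hg : ∀ x, HasGradientAt f (g x) x) (x y : E) :
    0 ≤ inner ℝ (g x - g y) (x - y) := by
  have h1 := hconv.add_inner_gradient_le hg x y
  have h2 := hconv.add_inner_gradient_le hg y x
  rw [← neg_sub x y, inner_neg_right] at h1
  rw [inner_sub_left]
  linarith

/-- The descent lemma: an upper bound on the variation of the gradient gives a quadratic upper
bound on the function. -/
theorem le_quadratic_of_inner_gradient_sub_le (hg : ∀ x, HasGradientAt f (g x) x)
    (hl : ∀ x y, inner ℝ (g x - g y) (x - y) ≤ l * ‖x - y‖ ^ 2) (x d : E) :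
    f (x + d) ≤ f x + inner ℝ (g x) d + l / 2 * ‖d‖ ^ 2 := by
  let φ : ℝ → ℝ := fun s => f (x + s • d) - s * inner ℝ (g x) d - l / 2 * ‖d‖ ^ 2 * s ^ 2
  have hφ : ∀ s, HasDerivAt φ
      (inner ℝ (g (x + s • d)) d - inner ℝ (g x) d - l * ‖d‖ ^ 2 * s) s := by
    intro s
    have h1 := HasGradientAt.hasDerivAt_comp_line (hg (x + s • d))
    have h2 := (h1.sub ((hasDerivAt_id s).mul_const (inner ℝ (g x) d))).sub
      ((hasDerivAt_pow 2 s).const_mul (l / 2 * ‖d‖ ^ 2))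
    refine h2.congr_deriv ?_
    simp
    ring
  have hanti : AntitoneOn φ (Set.Ici 0) := by
    refine antitoneOn_of_hasDerivWithinAt_nonpos (convex_Ici 0)
      (fun s _ => (hφ s).continuousAt.continuousWithinAt)
      (fun s _ => (hφ s).hasDerivWithinAt) ?_
    intro s hs
    rw [interior_Ici] at hs
    have hs : 0 < s := hs
    have h := hl (x + s • d) x
    rw [add_sub_cancel_left, inner_smul_right, norm_smul, Real.norm_of_nonneg hs.le] at h
    have : s * inner ℝ (g (x + s • d) - g x) d ≤ s * (l * ‖d‖ ^ 2 * s) := by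
      calc _ ≤ _ := h
        _ = _ := by ring
    have := le_of_mul_le_mul_left this hs
    rw [inner_sub_left] at this
    linarith
  have := hanti (Set.mem_Ici.2 le_rfl) (Set.mem_Ici.2 zero_le_one) zero_le_one
  simp [φ] at this
  linarith

/-- Half of the Baillon–Haddad inequality: a convex function with a quadratic upper bound lies
above its tangent by at least the squared variation of the gradient. It is the comparison of the
value of `f - ⟨g x, ·⟩` at its minimizer `x` with its value after one gradient step from `y`. -/
theorem ConvexOn.add_inner_gradient_add_le (hconv : ConvexOn ℝ Set.univ f)
    (hg : ∀ x, HasGradientAt f (g x) x) (hl0 : 0 < l)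
    (hl : ∀ x y, inner ℝ (g x - g y) (x - y) ≤ l * ‖x - y‖ ^ 2) (x y : E) :
    f x + inner ℝ (g x) (y - x) + ‖g y - g x‖ ^ 2 / (2 * l) ≤ f y := by
  set w := g y - g x with hw
  have h1 := le_quadratic_of_inner_gradient_sub_le hg hl y (-(l⁻¹ • w))
  have h2 := hconv.add_inner_gradient_le hg x (y + -(l⁻¹ • w))
  have e : y + -(l⁻¹ • w) - x = (y - x) - l⁻¹ • w := by abel
  rw [e, inner_sub_right, inner_smul_right] at h2
  rw [norm_neg, norm_smul, inner_neg_right, inner_smul_right, mul_pow,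
    Real.norm_of_nonneg (inv_nonneg.2 hl0.le)] at h1
  have h3 : inner ℝ (g y) w - inner ℝ (g x) w = ‖w‖ ^ 2 := by
    rw [← inner_sub_left, ← hw, real_inner_self_eq_norm_sq]
  have h4 : inner ℝ (g y) w = inner ℝ (g x) w + ‖w‖ ^ 2 := by linarith
  rw [h4] at h1
  have h5 : l / 2 * (l⁻¹ ^ 2 * ‖w‖ ^ 2) = l⁻¹ * ‖w‖ ^ 2 / 2 := by field_simp
  have h6 : ‖w‖ ^ 2 / (2 * l) = l⁻¹ * ‖w‖ ^ 2 / 2 := by field_simp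
  rw [h5] at h1
  rw [h6]
  linarith

/-- **Baillon–Haddad**: the gradient of a smooth convex function is cocoercive. -/
theorem ConvexOn.norm_gradient_sub_sq_le (hconv : ConvexOn ℝ Set.univ f)
    (hg : ∀ x, HasGradientAt f (g x) x) (hl0 : 0 < l)
    (hl : ∀ x y, inner ℝ (g x - g y) (x - y) ≤ l * ‖x - y‖ ^ 2) (x y : E) :
    ‖g x - g y‖ ^ 2 ≤ l * inner ℝ (g x - g y) (x - y) := by
  have h1 := hconv.add_inner_gradient_add_le hg hl0 hl x y
  have h2 := hconv.add_inner_gradient_add_le hg hl0 hl y x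
  rw [← neg_sub x y, inner_neg_right, norm_sub_rev] at h1
  have h3 : inner ℝ (g x - g y) (x - y) = inner ℝ (g x) (x - y) - inner ℝ (g y) (x - y) :=
    inner_sub_left _ _ _
  have h4 : ‖g x - g y‖ ^ 2 / (2 * l) + ‖g x - g y‖ ^ 2 / (2 * l) = ‖g x - g y‖ ^ 2 / l := by
    field_simp
    ring
  have h5 : ‖g x - g y‖ ^ 2 / l ≤ inner ℝ (g x - g y) (x - y) := by linarith
  rwa [div_le_iff₀' hl0] at h5

theorem norm_sub_le_mul_norm_sub_of_cocoercive {E : Type*} [NormedAddCommGroup E]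
    [InnerProductSpace ℝ E] {g : E → E} {l : ℝ} (hl0 : 0 < l)
    (hco : ∀ x y, ‖g x - g y‖ ^ 2 ≤ l * inner ℝ (g x - g y) (x - y)) (x y : E) :
    ‖g x - g y‖ ≤ l * ‖x - y‖ := by
  have h := (hco x y).trans (mul_le_mul_of_nonneg_left (real_inner_le_norm _ _) hl0.le)
  by_contra! hlt
  have h0 : 0 < ‖g x - g y‖ := lt_of_le_of_lt (by positivity) hlt
  nlinarith

/-- Strong monotonicity on an open half-space extends to the closed half-space. -/
theorem strongly_monotone_closed_halfSpace {E : Type*} [NormedAddCommGroup E]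
    [InnerProductSpace ℝ E] {g : E → E} {μ : ℝ} (hgc : Continuous g) {a : E} (ha : a ≠ 0) {β : ℝ}
    (h : ∀ x y, inner ℝ a x < β → inner ℝ a y < β →
      μ * ‖x - y‖ ^ 2 ≤ inner ℝ (g x - g y) (x - y))
    {x y : E} (hx : inner ℝ a x ≤ β) (hy : inner ℝ a y ≤ β) :
    μ * ‖x - y‖ ^ 2 ≤ inner ℝ (g x - g y) (x - y) := by
  have hc : Continuous fun ε : ℝ => inner ℝ (g (x - ε • a) - g (y - ε • a)) (x - y) := by
    fun_prop
  have ht : Filter.Tendsto (fun ε : ℝ => inner ℝ (g (x - ε • a) - g (y - ε • a)) (x - y))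
      (nhdsWithin 0 (Set.Ioi 0)) (nhds (inner ℝ (g x - g y) (x - y))) := by
    have := hc.tendsto 0
    simp only [zero_smul, sub_zero] at this
    exact this.mono_left nhdsWithin_le_nhds
  refine ge_of_tendsto ht ?_
  filter_upwards [self_mem_nhdsWithin] with ε hε
  have hε : 0 < ε := hε
  have hpos : 0 < ε * ‖a‖ ^ 2 := by positivity
  have key := h (x - ε • a) (y - ε • a)
    (by rw [inner_sub_right, inner_smul_right, real_inner_self_eq_norm_sq]; linarith)
    (by rw [inner_sub_right, inner_smul_right, real_inner_self_eq_norm_sq]; linarith)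
  rwa [sub_sub_sub_cancel_right] at key

/-- Error bound: with a cocoercive gradient that is strongly monotone on a half-space, the distance
to a point `xs` of the half-space is controlled by the monotonicity gap and the violation of the
constraint. Strong monotonicity is applied to the projection of `x` to the half-space. -/
theorem exists_norm_sub_sq_le_of_halfSpace {E : Type*} [NormedAddCommGroup E]
    [InnerProductSpace ℝ E] {g : E → E} {l μ : ℝ} (hl0 : 0 < l) (hμ : 0 < μ)
    (hco : ∀ x y, ‖g x - g y‖ ^ 2 ≤ l * inner ℝ (g x - g y) (x - y))
    {a : E} (ha : a ≠ 0) {β : ℝ}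
    (h : ∀ x y, inner ℝ a x ≤ β → inner ℝ a y ≤ β →
      μ * ‖x - y‖ ^ 2 ≤ inner ℝ (g x - g y) (x - y))
    {ρ : ℝ} (hρ : 0 < ρ) {xs : E} (hxs : inner ℝ a xs ≤ β) :
    ∃ c > 0, ∀ x, c * ‖x - xs‖ ^ 2 ≤
      inner ℝ (g x - g xs) (x - xs) + ρ * max (inner ℝ a x - β) 0 ^ 2 := by
  have ha' : 0 < ‖a‖ := norm_pos_iff.2 ha
  set K : ℝ := 2 * l + 2 * (l + μ) ^ 2 / (‖a‖ ^ 2 * ρ) with hK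
  have hKpos : 0 < K := by positivity
  refine ⟨μ ^ 2 / K, by positivity, fun x => ?_⟩
  set q := inner ℝ (g x - g xs) (x - xs)
  set v := max (inner ℝ a x - β) 0 with hv
  have hv0 : 0 ≤ v := le_max_right _ _
  have hv1 : inner ℝ a x - β ≤ v := le_max_left _ _
  have hq0 : 0 ≤ q := by
    have := (sq_nonneg _).trans (hco x xs)
    exact nonneg_of_mul_nonneg_right this hl0
  set x' := x - (v / ‖a‖ ^ 2) • a with hx'
  have hfeas : inner ℝ a x' ≤ β := by
    rw [hx', inner_sub_right, inner_smul_right, real_inner_self_eq_norm_sq,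
      div_mul_cancel₀ _ (by positivity)]
    linarith
  have hdist : ‖x - x'‖ = v / ‖a‖ := by
    rw [hx', sub_sub_cancel, norm_smul, Real.norm_of_nonneg (by positivity)]
    field_simp
  have h1 : μ * ‖x' - xs‖ ≤ ‖g x' - g xs‖ := by
    have h2 := (h x' xs hfeas hxs).trans (real_inner_le_norm _ _)
    rcases (norm_nonneg (x' - xs)).eq_or_lt with h0 | h0
    · rw [← h0, mul_zero]; positivity
    · refine le_of_mul_le_mul_right ?_ h0
      linarith
  have h2 : ‖g x' - g xs‖ ≤ ‖g x - g xs‖ + l * (v / ‖a‖) := by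
    have := norm_sub_le_norm_sub_add_norm_sub (g x') (g x) (g xs)
    have h3 := norm_sub_le_mul_norm_sub_of_cocoercive hl0 hco x' x
    rw [norm_sub_rev x', hdist] at h3
    linarith
  have h3 : ‖x - xs‖ ≤ v / ‖a‖ + ‖x' - xs‖ := by
    rw [← hdist]; exact norm_sub_le_norm_sub_add_norm_sub _ _ _
  have h4 : μ * ‖x - xs‖ ≤ ‖g x - g xs‖ + (l + μ) * (v / ‖a‖) := by nlinarith
  have h5 : (μ * ‖x - xs‖) ^ 2 ≤ 2 * ‖g x - g xs‖ ^ 2 + 2 * ((l + μ) * (v / ‖a‖)) ^ 2 := by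
    have := pow_le_pow_left₀ (by positivity) h4 2
    nlinarith [sq_nonneg (‖g x - g xs‖ - (l + μ) * (v / ‖a‖))]
  have h6 : 2 * ((l + μ) * (v / ‖a‖)) ^ 2 = 2 * (l + μ) ^ 2 / (‖a‖ ^ 2 * ρ) * (ρ * v ^ 2) := by
    field_simp
  rw [div_mul_eq_mul_div, div_le_iff₀ hKpos]
  have h7 := hco x xs
  have h8 : 0 ≤ 2 * (l + μ) ^ 2 / (‖a‖ ^ 2 * ρ) * q := by positivity
  have h9 : 0 ≤ 2 * l * (ρ * v ^ 2) := by positivity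
  calc μ ^ 2 * ‖x - xs‖ ^ 2 = (μ * ‖x - xs‖) ^ 2 := by ring
    _ ≤ 2 * (l * q) + 2 * (l + μ) ^ 2 / (‖a‖ ^ 2 * ρ) * (ρ * v ^ 2) := by
        rw [← h6]; linarith
    _ ≤ (q + ρ * v ^ 2) * K := by rw [hK]; linarith

/-- Strong monotonicity of the gradient on a convex set gives quadratic growth above the tangents.
The constant `μ / 4` instead of `μ / 2` comes from using the gradient at the midpoint only. -/
theorem ConvexOn.quadratic_growth (hconv : ConvexOn ℝ Set.univ f)
    (hg : ∀ x, HasGradientAt f (g x) x) {S : Set E} (hS : Convex ℝ S)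
    (h : ∀ x ∈ S, ∀ y ∈ S, μ * ‖x - y‖ ^ 2 ≤ inner ℝ (g x - g y) (x - y))
    {x y : E} (hx : x ∈ S) (hy : y ∈ S) :
    f x + inner ℝ (g x) (y - x) + μ / 4 * ‖y - x‖ ^ 2 ≤ f y := by
  set z := x + (1 / 2 : ℝ) • (y - x) with hz
  have hzS : z ∈ S := hS.add_smul_sub_mem hx hy ⟨by norm_num, by norm_num⟩
  have e1 : z - x = (1 / 2 : ℝ) • (y - x) := by rw [hz, add_sub_cancel_left]
  have e2 : y - z = (1 / 2 : ℝ) • (y - x) := by rw [hz]; module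
  have h1 := hconv.add_inner_gradient_le hg x z
  have h2 := hconv.add_inner_gradient_le hg z y
  have h3 := h z hzS x hx
  rw [e1, inner_smul_right] at h1
  rw [e2, inner_smul_right] at h2
  rw [e1, inner_smul_right, norm_smul, inner_sub_left, mul_pow] at h3
  norm_num at h3
  linarith

/-- A convex function whose gradient is strongly monotone on a nonempty closed convex set attains
its minimum there. -/
theorem ConvexOn.exists_isMinOn_of_strongly_monotone [ProperSpace E]
    (hconv : ConvexOn ℝ Set.univ f)
    (hg : ∀ x, HasGradientAt f (g x) x) {S : Set E} (hS : Convex ℝ S) (hSc : IsClosed S)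
    (hne : S.Nonempty) (hμ : 0 < μ)
    (h : ∀ x ∈ S, ∀ y ∈ S, μ * ‖x - y‖ ^ 2 ≤ inner ℝ (g x - g y) (x - y)) :
    ∃ x ∈ S, IsMinOn f S x := by
  obtain ⟨x₀, hx₀⟩ := hne
  have hfc : Continuous f := continuous_iff_continuousAt.2 fun x => (hg x).continuousAt
  refine hfc.continuousOn.exists_isMinOn' hSc hx₀ ?_
  rw [Filter.eventually_inf_principal, ← Metric.cobounded_eq_cocompact]
  have hb : ∀ᶠ y in Bornology.cobounded E, 4 / μ * ‖g x₀‖ + ‖x₀‖ ≤ ‖y‖ :=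
    tendsto_norm_cobounded_atTop.eventually_ge_atTop _
  filter_upwards [hb] with y hy hyS
  have h1 := hconv.quadratic_growth hg hS h hx₀ hyS
  have h2 : -(‖g x₀‖ * ‖y - x₀‖) ≤ inner ℝ (g x₀) (y - x₀) :=
    (abs_le.1 (abs_real_inner_le_norm _ _)).1
  have h3 : 4 / μ * ‖g x₀‖ ≤ ‖y - x₀‖ := by
    have := norm_sub_norm_le y x₀
    linarith
  have h4 : ‖g x₀‖ ≤ μ / 4 * ‖y - x₀‖ := by
    rw [div_mul_eq_mul_div, div_le_iff₀ hμ] at h3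
    linarith
  nlinarith [mul_le_mul_of_nonneg_right h4 (norm_nonneg (y - x₀))]

end SmoothConvex

/-! ### Global solutions of globally Lipschitz differential equations -/

section GlobalFlow

variable {E : Type*} [NormedAddCommGroup E] [NormedSpace ℝ E] {v : E → E}

open Set

/-- For a globally Lipschitz field the Picard–Lindelöf time step does not depend on the initial
point. -/
theorem LipschitzWith.exists_uniform_time_solution [CompleteSpace E] {K : NNReal}
    (hv : LipschitzWith K v) (z : E) :
    ∃ γ : ℝ → E, γ 0 = z ∧ ∀ t ∈ Icc (0 : ℝ) (1 / (K + 1)),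
      HasDerivWithinAt γ (v (γ t)) (Icc (0 : ℝ) (1 / (K + 1))) t := by
  have hε : (0 : ℝ) ≤ 1 / (K + 1) := by positivity
  -- On the ball of radius `‖v z‖ + 1` the field is bounded by `(K + 1)` times the radius.
  have hpl : IsPicardLindelof (fun _ => v) (⟨0, ⟨le_rfl, hε⟩⟩ : Icc (0 : ℝ) (1 / (K + 1))) z
      (‖v z‖₊ + 1) 0 (‖v z‖₊ + K * (‖v z‖₊ + 1)) K := by
    refine IsPicardLindelof.of_time_independent ?_ (hv.lipschitzOnWith) ?_
    · intro x hx
      have h1 := hv.norm_sub_le x z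
      have h2 : ‖x - z‖ ≤ ‖v z‖ + 1 := by simpa [dist_eq_norm] using hx
      have h3 := norm_le_insert' (v x) (v z)
      have h4 := mul_le_mul_of_nonneg_left h2 K.coe_nonneg
      push_cast
      linarith
    · have hK : (0 : ℝ) < K + 1 := by positivity
      simp only [sub_zero, sub_self, max_eq_left hε]
      push_cast
      rw [mul_one_div, div_le_iff₀ hK]
      nlinarith [norm_nonneg (v z)]
  obtain ⟨γ, h0, h⟩ := hpl.exists_eq_forall_mem_Icc_hasDerivWithinAt₀
  exact ⟨γ, h0, h⟩

/-- Concatenation of a solution on `[0, a]` with a solution on `[0, ε]`. -/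
theorem exists_solution_concat {a ε : ℝ} (ha : 0 ≤ a) (hε : 0 ≤ ε) {γ δ : ℝ → E}
    (hγ : ∀ t ∈ Icc 0 a, HasDerivWithinAt γ (v (γ t)) (Icc 0 a) t)
    (hδ : ∀ t ∈ Icc 0 ε, HasDerivWithinAt δ (v (δ t)) (Icc 0 ε) t) (h0 : δ 0 = γ a) :
    ∃ η : ℝ → E, η 0 = γ 0 ∧
      ∀ t ∈ Icc 0 (a + ε), HasDerivWithinAt η (v (η t)) (Icc 0 (a + ε)) t := by
  classical
  let η : ℝ → E := fun t => if t ≤ a then γ t else δ (t - a)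
  have hη1 : ∀ t ∈ Icc 0 a, η t = γ t := fun t ht => if_pos ht.2
  have hη2 : ∀ t ∈ Icc a (a + ε), η t = δ (t - a) := by
    intro t ht
    rcases ht.1.eq_or_lt with rfl | h
    · simp [η, h0]
    · exact if_neg h.not_ge
  refine ⟨η, if_pos ha, fun t _ => ?_⟩
  rw [← Icc_union_Icc_eq_Icc ha (by linarith : a ≤ a + ε)]
  refine HasDerivWithinAt.union ?_ ?_
  · by_cases ht : t ∈ Icc 0 a
    · rw [hη1 t ht]
      exact (hγ t ht).congr hη1 (hη1 t ht)
    · exact HasFDerivWithinAt.of_notMem_closure (by rwa [isClosed_Icc.closure_eq])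
  · by_cases ht : t ∈ Icc a (a + ε)
    · rw [hη2 t ht]
      have ht' : t - a ∈ Icc 0 ε := ⟨by linarith [ht.1], by linarith [ht.2]⟩
      have h1 : HasDerivWithinAt (fun s => s - a) 1 (Icc a (a + ε)) t :=
        (hasDerivWithinAt_id t _).sub_const a
      have hmaps : MapsTo (fun s => s - a) (Icc a (a + ε)) (Icc 0 ε) :=
        fun s hs => ⟨by linarith [hs.1], by linarith [hs.2]⟩
      have h2 := (hδ (t - a) ht').scomp t h1 hmaps
      rw [one_smul] at h2
      exact h2.congr hη2 (hη2 t ht)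
    · exact HasFDerivWithinAt.of_notMem_closure (by rwa [isClosed_Icc.closure_eq])

theorem LipschitzWith.exists_solution_Icc_nat_mul [CompleteSpace E] {K : NNReal}
    (hv : LipschitzWith K v) (z : E) (N : ℕ) :
    ∃ γ : ℝ → E, γ 0 = z ∧ ∀ t ∈ Icc (0 : ℝ) (N * (1 / (K + 1))),
      HasDerivWithinAt γ (v (γ t)) (Icc (0 : ℝ) (N * (1 / (K + 1)))) t := by
  induction N with
  | zero =>
    refine ⟨fun _ => z, rfl, fun t _ => ?_⟩
    simp only [Nat.cast_zero, zero_mul, Icc_self]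
    exact HasFDerivWithinAt.of_subsingleton subsingleton_singleton
  | succ N ih =>
    obtain ⟨γ, h0, hγ⟩ := ih
    obtain ⟨δ, hδ0, hδ⟩ := hv.exists_uniform_time_solution (γ (N * (1 / (K + 1))))
    obtain ⟨η, hη0, hη⟩ := exists_solution_concat (by positivity) (by positivity) hγ hδ hδ0
    refine ⟨η, hη0.trans h0, ?_⟩
    rwa [Nat.cast_succ, add_mul, one_mul]

/-- Global existence: a globally Lipschitz field has a solution on `[0, ∞)` from every initial
point. -/
theorem LipschitzWith.exists_global_solution [CompleteSpace E] {K : NNReal}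
    (hv : LipschitzWith K v) (z : E) :
    ∃ γ : ℝ → E, γ 0 = z ∧ ∀ t, 0 ≤ t → HasDerivWithinAt γ (v (γ t)) (Ici 0) t := by
  choose γ h0 hγ using hv.exists_solution_Icc_nat_mul z
  set ε : ℝ := 1 / (K + 1) with hεdef
  have hε : 0 < ε := by positivity
  have hagree : ∀ M N : ℕ, M ≤ N → EqOn (γ M) (γ N) (Icc 0 (M * ε)) := by
    intro M N hMN
    have hle : (M : ℝ) * ε ≤ N * ε := by gcongr
    have hmem : ∀ (P : ℕ), (M : ℝ) * ε ≤ P * ε → ∀ t ∈ Ico 0 (M * ε),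
        HasDerivWithinAt (γ P) (v (γ P t)) (Ici t) t := by
      intro P hP t ht
      refine (hγ P t ⟨ht.1, ht.2.le.trans hP⟩).mono_of_mem_nhdsWithin ?_
      exact Filter.mem_of_superset (Icc_mem_nhdsGE (ht.2.trans_le hP))
        (Icc_subset_Icc_left ht.1)
    have hcont : ∀ (P : ℕ), (M : ℝ) * ε ≤ P * ε → ContinuousOn (γ P) (Icc 0 (M * ε)) :=
      fun P hP t ht => ((hγ P t ⟨ht.1, ht.2.trans hP⟩).continuousWithinAt).mono
        (Icc_subset_Icc_right hP)
    exact ODE_solution_unique_of_mem_Icc_right (v := fun _ => v) (s := fun _ => univ) (K := K)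
      (fun _ _ => hv.lipschitzOnWith) (hcont M le_rfl) (hmem M le_rfl) (fun _ _ => mem_univ _)
      (hcont N hle) (hmem N hle) (fun _ _ => mem_univ _) (by rw [h0, h0])
  have hfloor : ∀ t, 0 ≤ t → t < (⌊t / ε⌋₊ + 1 : ℕ) * ε := by
    intro t _
    have := Nat.lt_floor_add_one (t / ε)
    rw [div_lt_iff₀ hε] at this
    exact_mod_cast this
  refine ⟨fun t => γ (⌊t / ε⌋₊ + 1) t, h0 _, fun t ht => ?_⟩
  -- Near `t` the glued curve coincides with a single solution on a longer interval.
  obtain ⟨N, hN⟩ : ∃ N, N = ⌊t / ε⌋₊ + 1 := ⟨_, rfl⟩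
  have htN : t < N * ε := by rw [hN]; exact hfloor t ht
  have heq : ∀ s ∈ Ico 0 (N * ε), γ (⌊s / ε⌋₊ + 1) s = γ N s := by
    intro s hs
    rcases le_total (⌊s / ε⌋₊ + 1) N with h | h
    · exact hagree _ _ h ⟨hs.1, (hfloor s hs.1).le⟩
    · exact (hagree _ _ h ⟨hs.1, hs.2.le⟩).symm
  have h1 : HasDerivWithinAt (γ N) (v (γ N t)) (Ico 0 (N * ε)) t :=
    (hγ N t ⟨ht, htN.le⟩).mono Ico_subset_Icc_self
  have h2 := h1.congr heq (heq t ⟨ht, htN⟩)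
  rw [← heq t ⟨ht, htN⟩] at h2
  refine h2.mono_of_mem_nhdsWithin ?_
  rw [← Ici_inter_Iio]
  exact inter_mem_nhdsWithin _ (Iio_mem_nhds htN)

end GlobalFlow

/-! ### Exponential decay from a Lyapunov function -/

/-- A differential inequality `W' ≤ -β W` gives exponential decay. -/
theorem le_exp_mul_of_hasDerivWithinAt_le {W W' : ℝ → ℝ} {β : ℝ}
    (hW : ∀ t, 0 ≤ t → HasDerivWithinAt W (W' t) (Set.Ici 0) t)
    (h : ∀ t, 0 ≤ t → W' t ≤ -β * W t) {t : ℝ} (ht : 0 ≤ t) :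
    W t ≤ Real.exp (-β * t) * W 0 := by
  have hd : ∀ s, 0 ≤ s → HasDerivWithinAt (fun s => Real.exp (β * s) * W s)
      (Real.exp (β * s) * (β * W s + W' s)) (Set.Ici 0) s := by
    intro s hs
    have h1 : HasDerivAt (fun s : ℝ => Real.exp (β * s)) (Real.exp (β * s) * β) s := by
      simpa using ((hasDerivAt_id s).const_mul β).exp
    refine (h1.hasDerivWithinAt.mul (hW s hs)).congr_deriv ?_
    ring
  have hanti : AntitoneOn (fun s => Real.exp (β * s) * W s) (Set.Ici 0) := by
    refine antitoneOn_of_hasDerivWithinAt_nonpos (convex_Ici 0)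
      (fun s hs => (hd s hs).continuousWithinAt)
      (fun s hs => (hd s (interior_subset hs)).mono interior_subset) ?_
    intro s hs
    have := h s (interior_subset hs)
    exact mul_nonpos_of_nonneg_of_nonpos (Real.exp_pos _).le (by linarith)
  have := hanti (Set.mem_Ici.2 le_rfl) ht ht
  simp only [mul_zero, Real.exp_zero, one_mul] at this
  rw [neg_mul, Real.exp_neg, ← div_eq_inv_mul, le_div_iff₀ (Real.exp_pos _)]
  linarith

section Decay

variable {E F : Type*} [NormedAddCommGroup E] [InnerProductSpace ℝ E]
  [NormedAddCommGroup F] [InnerProductSpace ℝ F]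

/-- Upper bound on the derivative of the cross term `⟨ξ, A η⟩` along the error system
`ξ' = -G - A (η + r)`, `η' = r / ρ`: it dissipates `η`, up to terms in `ξ`, `G` and `r`. -/
theorem cross_term_deriv_le (A : F →L[ℝ] E) {M : ℝ} (hM : ∀ u, ‖A u‖ ≤ M * ‖u‖)
    {ρ : ℝ} (hρ : 0 < ρ) (ξ G : E) (η r : F) :
    inner ℝ (-G - A (η + r)) (A η) + inner ℝ ξ (A (ρ⁻¹ • r)) ≤
      -(1 / 2) * ‖A η‖ ^ 2 + ‖G‖ ^ 2 + 1 / 2 * ‖ξ‖ ^ 2 +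
        (M ^ 2 + M ^ 2 / (2 * ρ ^ 2)) * ‖r‖ ^ 2 := by
  have h1 : ‖A r‖ ^ 2 ≤ M ^ 2 * ‖r‖ ^ 2 := by
    rw [← mul_pow]; exact pow_le_pow_left₀ (norm_nonneg _) (hM r) 2
  have h2 : inner ℝ (-G - A (η + r)) (A η) =
      -inner ℝ G (A η) - ‖A η‖ ^ 2 - inner ℝ (A r) (A η) := by
    rw [map_add, inner_sub_left, inner_add_left, inner_neg_left, real_inner_self_eq_norm_sq]
    ring
  have h3 : -inner ℝ G (A η) ≤ ‖G‖ * ‖A η‖ := by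
    linarith [(abs_le.1 (abs_real_inner_le_norm G (A η))).1]
  have h4 : -inner ℝ (A r) (A η) ≤ ‖A r‖ * ‖A η‖ := by
    linarith [(abs_le.1 (abs_real_inner_le_norm (A r) (A η))).1]
  have h5 : inner ℝ ξ (A (ρ⁻¹ • r)) ≤ ‖ξ‖ * (ρ⁻¹ * ‖A r‖) := by
    refine (real_inner_le_norm _ _).trans_eq ?_
    rw [map_smul, norm_smul, Real.norm_of_nonneg (by positivity)]
  have h6 : ‖ξ‖ * (ρ⁻¹ * ‖A r‖) ≤ 1 / 2 * ‖ξ‖ ^ 2 + 1 / 2 * (ρ⁻¹ * ‖A r‖) ^ 2 := by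
    nlinarith [sq_nonneg (‖ξ‖ - ρ⁻¹ * ‖A r‖)]
  have h7 : 1 / 2 * (ρ⁻¹ * ‖A r‖) ^ 2 ≤ M ^ 2 / (2 * ρ ^ 2) * ‖r‖ ^ 2 := by
    calc 1 / 2 * (ρ⁻¹ * ‖A r‖) ^ 2 = 1 / (2 * ρ ^ 2) * ‖A r‖ ^ 2 := by field_simp
      _ ≤ 1 / (2 * ρ ^ 2) * (M ^ 2 * ‖r‖ ^ 2) := by gcongr
      _ = _ := by ring
  nlinarith [sq_nonneg (2 * ‖G‖ - ‖A η‖), sq_nonneg (2 * ‖A r‖ - ‖A η‖)]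

/-- Exponential decay for the error system `ξ' = -G - A (η + r)`, `η' = r / ρ`. The energy
`V = (‖ξ‖² + ‖η‖²) / 2` dissipates `ξ`, `G` and `r` but not `η`; the Lyapunov function is
`K V + ⟨ξ, A η⟩`, whose cross term supplies the missing dissipation because `A` is injective. -/
theorem exists_exponential_decay (A : F →L[ℝ] E) {σ ρ l c : ℝ} (hσ : 0 < σ) (hρ : 0 < ρ)
    (hl : 0 < l) (hc : 0 < c) (hA : ∀ u, σ * ‖u‖ ^ 2 ≤ ‖A u‖ ^ 2) :
    ∃ C α : ℝ, 0 < C ∧ 0 < α ∧ ∀ (ξ G : ℝ → E) (η r : ℝ → F),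
      (∀ t, 0 ≤ t → HasDerivWithinAt ξ (-G t - A (η t + r t)) (Set.Ici 0) t) →
      (∀ t, 0 ≤ t → HasDerivWithinAt η (ρ⁻¹ • r t) (Set.Ici 0) t) →
      (∀ t, 0 ≤ t → ‖G t‖ ^ 2 ≤ l * inner ℝ (G t) (ξ t)) →
      (∀ t, 0 ≤ t → ρ⁻¹ * ‖r t‖ ^ 2 ≤
        inner ℝ (A (η t + r t)) (ξ t) - ρ⁻¹ * inner ℝ (η t) (r t)) →
      (∀ t, 0 ≤ t → c * ‖ξ t‖ ^ 2 ≤ inner ℝ (G t) (ξ t) + ρ⁻¹ * ‖r t‖ ^ 2) →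
      ∀ t, 0 ≤ t → ‖ξ t‖ ≤ C * Real.exp (-α * t) * Real.sqrt (‖ξ 0‖ ^ 2 + ‖η 0‖ ^ 2) := by
  set M := ‖A‖
  have hM0 : 0 ≤ M := norm_nonneg A
  have hM : ∀ u, ‖A u‖ ≤ M * ‖u‖ := A.le_opNorm
  -- `C₁` times the dissipation of `V` dominates the derivative of the cross term except for
  -- `-‖A η‖² / 2`.
  set C₁ : ℝ := l + M ^ 2 * ρ + 1 / (2 * c) + M ^ 2 / (2 * ρ) with hC₁
  have hC₁0 : 0 < C₁ := by positivity
  -- The summand `1 + M` of `K` makes `W ≥ (‖ξ‖² + ‖η‖²) / 2` and leaves dissipation to spare.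
  set K : ℝ := C₁ + 1 + M with hK
  set κ : ℝ := min c (σ / 2)
  have hκ : 0 < κ := lt_min hc (by positivity)
  have hKM : 0 < K + M := by positivity
  set β : ℝ := 2 * κ / (K + M) with hβ
  have hβ0 : 0 < β := by positivity
  refine ⟨Real.sqrt (K + M), β / 2, Real.sqrt_pos.2 hKM, by positivity, ?_⟩
  intro ξ G η r hξ hη hG hr hdiss t ht
  set W : ℝ → ℝ := fun s => K / 2 * (‖ξ s‖ ^ 2 + ‖η s‖ ^ 2) + inner ℝ (ξ s) (A (η s)) with hW
  have hcross : ∀ s, |inner ℝ (ξ s) (A (η s))| ≤ M / 2 * (‖ξ s‖ ^ 2 + ‖η s‖ ^ 2) := by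
    intro s
    have h1 := abs_real_inner_le_norm (ξ s) (A (η s))
    have h2 := mul_le_mul_of_nonneg_left (hM (η s)) (norm_nonneg (ξ s))
    nlinarith [mul_nonneg hM0 (sq_nonneg (‖ξ s‖ - ‖η s‖))]
  have hWderiv : ∀ s, 0 ≤ s → HasDerivWithinAt W
      (K * (inner ℝ (ξ s) (-G s - A (η s + r s)) + inner ℝ (η s) (ρ⁻¹ • r s)) +
        (inner ℝ (ξ s) (A (ρ⁻¹ • r s)) + inner ℝ (-G s - A (η s + r s)) (A (η s))))
      (Set.Ici 0) s := by
    intro s hs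
    have h1 := (((hξ s hs).norm_sq.add (hη s hs).norm_sq).const_mul (K / 2)).add
      ((hξ s hs).inner ℝ (A.hasFDerivAt.comp_hasDerivWithinAt s (hη s hs)))
    refine h1.congr_deriv ?_
    simp only [Function.comp]
    ring
  have hWle : ∀ s, W s ≤ (K + M) / 2 * (‖ξ s‖ ^ 2 + ‖η s‖ ^ 2) := by
    intro s
    have := (abs_le.1 (hcross s)).2
    simp only [hW]
    linarith
  have hWge : ∀ s, 1 / 2 * (‖ξ s‖ ^ 2 + ‖η s‖ ^ 2) ≤ W s := by
    intro s
    have h1 := (abs_le.1 (hcross s)).1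
    have h2 : 0 ≤ C₁ * (‖ξ s‖ ^ 2 + ‖η s‖ ^ 2) := by positivity
    simp only [hW, hK]
    linarith
  have hdecay : ∀ s, 0 ≤ s →
      K * (inner ℝ (ξ s) (-G s - A (η s + r s)) + inner ℝ (η s) (ρ⁻¹ • r s)) +
        (inner ℝ (ξ s) (A (ρ⁻¹ • r s)) + inner ℝ (-G s - A (η s + r s)) (A (η s))) ≤
      -β * W s := by
    intro s hs
    have h1 := cross_term_deriv_le A hM hρ (ξ s) (G s) (η s) (r s)
    have h2 := hG s hs
    have h3 := hr s hs
    have h4 := hdiss s hs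
    have h5 := hA (η s)
    have h6 : inner ℝ (ξ s) (-G s - A (η s + r s)) + inner ℝ (η s) (ρ⁻¹ • r s) =
        -inner ℝ (G s) (ξ s) - (inner ℝ (A (η s + r s)) (ξ s) - ρ⁻¹ * inner ℝ (η s) (r s)) := by
      rw [inner_sub_right, inner_neg_right, inner_smul_right, real_inner_comm (G s),
        real_inner_comm (A (η s + r s))]
      ring
    have hq0 : 0 ≤ inner ℝ (G s) (ξ s) :=
      nonneg_of_mul_nonneg_right ((sq_nonneg _).trans h2) hl
    have he0 : 0 ≤ ρ⁻¹ * ‖r s‖ ^ 2 := by positivity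
    set q := inner ℝ (G s) (ξ s)
    set e := ρ⁻¹ * ‖r s‖ ^ 2 with he
    have her : ‖r s‖ ^ 2 = ρ * e := by rw [he]; field_simp
    rw [h6]
    have hV : -q - (inner ℝ (A (η s + r s)) (ξ s) - ρ⁻¹ * inner ℝ (η s) (r s)) ≤ -(q + e) := by
      linarith
    have hKpos : 0 ≤ K := by positivity
    have h7 := mul_le_mul_of_nonneg_left hV hKpos
    have hX : 1 / 2 * ‖ξ s‖ ^ 2 ≤ 1 / (2 * c) * (q + e) := by
      calc 1 / 2 * ‖ξ s‖ ^ 2 = 1 / (2 * c) * (c * ‖ξ s‖ ^ 2) := by field_simp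
        _ ≤ _ := by gcongr
    have hr' : (M ^ 2 + M ^ 2 / (2 * ρ ^ 2)) * ‖r s‖ ^ 2 =
        (M ^ 2 * ρ + M ^ 2 / (2 * ρ)) * e := by rw [her]; field_simp
    rw [hr'] at h1
    have h8 : inner ℝ (ξ s) (A (ρ⁻¹ • r s)) + inner ℝ (-G s - A (η s + r s)) (A (η s)) ≤
        -(σ / 2) * ‖η s‖ ^ 2 + C₁ * (q + e) := by
      have h9 : 0 ≤ (M ^ 2 * ρ + M ^ 2 / (2 * ρ)) * q := by positivity
      have h10 : 0 ≤ l * e := by positivity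
      rw [hC₁]
      linarith
    have h9 : 0 ≤ M * (q + e) := by positivity
    have h10 : κ * (‖ξ s‖ ^ 2 + ‖η s‖ ^ 2) ≤ c * ‖ξ s‖ ^ 2 + σ / 2 * ‖η s‖ ^ 2 := by
      have h11 := mul_le_mul_of_nonneg_right (min_le_left c (σ / 2)) (sq_nonneg ‖ξ s‖)
      have h12 := mul_le_mul_of_nonneg_right (min_le_right c (σ / 2)) (sq_nonneg ‖η s‖)
      linarith
    have h11 : β * W s ≤ κ * (‖ξ s‖ ^ 2 + ‖η s‖ ^ 2) := by
      calc β * W s ≤ β * ((K + M) / 2 * (‖ξ s‖ ^ 2 + ‖η s‖ ^ 2)) := by gcongr; exact hWle s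
        _ = _ := by rw [hβ]; field_simp
    have h12 : K * -(q + e) = -C₁ * (q + e) - (q + e) - M * (q + e) := by rw [hK]; ring
    linarith
  have hmain := le_exp_mul_of_hasDerivWithinAt_le hWderiv hdecay ht
  have hexp : Real.exp (-β * t) = Real.exp (-(β / 2) * t) ^ 2 := by
    rw [sq, ← Real.exp_add]; congr 1; ring
  have hsq : ‖ξ t‖ ^ 2 ≤ (Real.sqrt (K + M) * Real.exp (-(β / 2) * t) *
      Real.sqrt (‖ξ 0‖ ^ 2 + ‖η 0‖ ^ 2)) ^ 2 := by
    rw [mul_pow, mul_pow, Real.sq_sqrt hKM.le, Real.sq_sqrt (by positivity), ← hexp]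
    have h1 := mul_le_mul_of_nonneg_left (hWle 0) (Real.exp_pos (-β * t)).le
    have h2 := hWge t
    have h3 := sq_nonneg ‖η t‖
    linarith
  exact (sq_le_sq₀ (norm_nonneg _) (by positivity)).1 hsq

end Decay

noncomputable section

namespace AugPrimalDual

variable {n m : ℕ} {f : EuclideanSpace ℝ (Fin n) → ℝ} {T : Matrix (Fin n) (Fin m) ℝ}
  {b : Fin m → ℝ} {l μ ρ : ℝ}

/-! ### The constraint map -/

/-- The linear map `u ↦ ∑ j, u j • T_j`, that is, `u ↦ T u` between Euclidean spaces. -/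
def synthesis (T : Matrix (Fin n) (Fin m) ℝ) :
    EuclideanSpace ℝ (Fin m) →L[ℝ] EuclideanSpace ℝ (Fin n) :=
  ∑ j, (EuclideanSpace.proj j : EuclideanSpace ℝ (Fin m) →L[ℝ] ℝ).smulRight (column T j)

theorem synthesis_apply (T : Matrix (Fin n) (Fin m) ℝ) (u : EuclideanSpace ℝ (Fin m)) :
    synthesis T u = ∑ j, u j • column T j := by
  simp [synthesis]

theorem inner_synthesis (T : Matrix (Fin n) (Fin m) ℝ) (u : EuclideanSpace ℝ (Fin m))
    (x : EuclideanSpace ℝ (Fin n)) :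
    inner ℝ (synthesis T u) x = ∑ j, u j * inner ℝ (column T j) x := by
  simp [synthesis_apply, sum_inner, inner_smul_left]

theorem transpose_mulVec_apply (T : Matrix (Fin n) (Fin m) ℝ) (x : EuclideanSpace ℝ (Fin n))
    (j : Fin m) : (Tᵀ *ᵥ x.ofLp) j = inner ℝ (column T j) x := by
  simp [column, Matrix.mulVec, dotProduct, PiLp.inner_apply, mul_comm]

theorem exists_inner_column_eq (hrank : Tᵀ.rank = m) (w : Fin m → ℝ) :
    ∃ x : EuclideanSpace ℝ (Fin n), ∀ j, inner ℝ (column T j) x = w j := by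
  have htop : LinearMap.range Tᵀ.mulVecLin = ⊤ := by
    apply Submodule.eq_top_of_finrank_eq
    rw [Module.finrank_fin_fun]
    exact hrank
  obtain ⟨x, hx⟩ := LinearMap.range_eq_top.1 htop w
  refine ⟨WithLp.toLp 2 x, fun j => ?_⟩
  rw [← transpose_mulVec_apply, ← hx]
  rfl

theorem column_ne_zero (hrank : Tᵀ.rank = m) (j : Fin m) : column T j ≠ 0 := by
  intro h
  obtain ⟨x, hx⟩ := exists_inner_column_eq hrank (fun _ => 1)
  have := hx j
  rw [h, inner_zero_left] at this
  exact zero_ne_one this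

theorem exists_mul_norm_sq_le_norm_synthesis_sq (hrank : Tᵀ.rank = m) :
    ∃ σ > 0, ∀ u, σ * ‖u‖ ^ 2 ≤ ‖synthesis T u‖ ^ 2 := by
  have hinj : LinearMap.ker (synthesis T).toLinearMap = ⊥ := by
    refine LinearMap.ker_eq_bot'.2 fun u hu => ?_
    obtain ⟨x, hx⟩ := exists_inner_column_eq hrank u.ofLp
    have h1 : inner ℝ (synthesis T u) x = 0 := by
      rw [show synthesis T u = 0 from hu, inner_zero_left]
    rw [inner_synthesis] at h1
    simp only [hx] at h1
    have h2 : ‖u‖ ^ 2 = 0 := by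
      rw [EuclideanSpace.real_norm_sq_eq, ← h1]
      exact Finset.sum_congr rfl fun j _ => sq _
    simpa using h2
  obtain ⟨K, hK, hanti⟩ := (synthesis T).toLinearMap.exists_antilipschitzWith hinj
  have hK' : (0 : ℝ) < K := hK
  refine ⟨1 / (K : ℝ) ^ 2, by positivity, fun u => ?_⟩
  have h1 : ‖u‖ ≤ K * ‖synthesis T u‖ := by
    simpa using hanti.le_mul_dist u 0
  have h2 := pow_le_pow_left₀ (norm_nonneg u) h1 2
  rw [div_mul_eq_mul_div, div_le_iff₀ (by positivity), one_mul]
  rw [mul_pow] at h2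
  exact h2.trans_eq (mul_comm _ _)

theorem mem_feasibleSet_iff {x : EuclideanSpace ℝ (Fin n)} :
    x ∈ feasibleSet T b ↔ ∀ j, inner ℝ (column T j) x ≤ b j := by
  simp only [feasibleSet, Set.mem_ofPred_eq, transpose_mulVec_apply]

theorem feasibleSet_eq_iInter :
    feasibleSet T b = ⋂ j, {x | inner ℝ (column T j) x ≤ b j} := by
  ext x
  simp [mem_feasibleSet_iff]

theorem convex_feasibleSet : Convex ℝ (feasibleSet T b) := by
  rw [feasibleSet_eq_iInter]
  exact convex_iInter fun j =>
    convex_halfSpace_le (innerSL ℝ (column T j)).toLinearMap.isLinear (b j)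

theorem isClosed_feasibleSet : IsClosed (feasibleSet T b) := by
  rw [feasibleSet_eq_iInter]
  exact isClosed_iInter fun j => isClosed_le (by fun_prop) continuous_const

/-! ### Optimality and multipliers -/

theorem isOptimal_iff_isMinOn {x : EuclideanSpace ℝ (Fin n)} :
    IsOptimal f T b x ↔ x ∈ feasibleSet T b ∧ IsMinOn f (feasibleSet T b) x :=
  Iff.rfl

theorem IsOptimal.inner_gradient_nonneg {x v : EuclideanSpace ℝ (Fin n)}
    (h : IsOptimal f T b x) (hg : HasGradientAt f v x) {y : EuclideanSpace ℝ (Fin n)}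
    (hy : y ∈ feasibleSet T b) : 0 ≤ inner ℝ v (y - x) := by
  have hmin : IsLocalMinOn f (feasibleSet T b) x := (isOptimal_iff_isMinOn.1 h).2.localize
  have := hmin.hasFDerivWithinAt_nonneg hg.hasFDerivAt.hasFDerivWithinAt
    (sub_mem_posTangentConeAt_of_segment_subset (convex_feasibleSet.segment_subset h.1 hy))
  rwa [InnerProductSpace.toDual_apply_apply] at this

/-- Karush–Kuhn–Tucker conditions. As the columns are linearly independent, they have a dual system
`e`, the multipliers are `-⟨v, e j⟩`, and the signs come from comparing `x` with the feasible
points obtained by moving along `e j`. -/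
theorem exists_kkt_multiplier (hrank : Tᵀ.rank = m) {x v : EuclideanSpace ℝ (Fin n)}
    (hx : x ∈ feasibleSet T b) (hv : ∀ y ∈ feasibleSet T b, 0 ≤ inner ℝ v (y - x)) :
    ∃ lam : EuclideanSpace ℝ (Fin m), v + synthesis T lam = 0 ∧
      ∀ j, 0 ≤ lam j ∧ lam j * (inner ℝ (column T j) x - b j) = 0 := by
  rw [mem_feasibleSet_iff] at hx
  choose e he using fun j : Fin m => exists_inner_column_eq hrank (Pi.single j (1 : ℝ))
  refine ⟨WithLp.toLp 2 fun j => -inner ℝ v (e j), ?_, fun j => ?_⟩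
  · refine ext_inner_right ℝ fun d => ?_
    -- Moving along the kernel of `Tᵀ` in either direction stays feasible, so `v` vanishes on it.
    have hker : ∀ k, inner ℝ (column T k) (∑ j, inner ℝ (column T j) d • e j - d) = 0 := by
      intro k
      simp [inner_sub_right, inner_sum, inner_smul_right, he, Pi.single_apply]
    have h1 := hv (x + (∑ j, inner ℝ (column T j) d • e j - d))
      (mem_feasibleSet_iff.2 fun k => by rw [inner_add_right, hker, add_zero]; exact hx k)
    have h2 := hv (x + -(∑ j, inner ℝ (column T j) d • e j - d))
      (mem_feasibleSet_iff.2 fun k => by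
        rw [inner_add_right, inner_neg_right, hker, neg_zero, add_zero]; exact hx k)
    rw [add_sub_cancel_left] at h1 h2
    rw [inner_neg_right] at h2
    have h3 : inner ℝ v (∑ j, inner ℝ (column T j) d • e j - d) = 0 := by linarith
    rw [inner_sub_right, inner_sum] at h3
    simp only [inner_smul_right] at h3
    rw [inner_add_left, inner_synthesis, inner_zero_left]
    have h4 : ∑ j, -inner ℝ v (e j) * inner ℝ (column T j) d =
        -∑ j, inner ℝ (column T j) d * inner ℝ v (e j) := by
      rw [← Finset.sum_neg_distrib]
      exact Finset.sum_congr rfl fun j _ => by ring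
    rw [h4]
    linarith
  · -- `x - e j` relaxes the constraint `j`, and adding a multiple of `e j` makes it active.
    have h1 : 0 ≤ -inner ℝ v (e j) := by
      have := hv (x - e j) (mem_feasibleSet_iff.2 fun k => by
        rw [inner_sub_right, he, Pi.single_apply]
        have := hx k
        split_ifs <;> linarith)
      rwa [sub_sub_cancel_left, inner_neg_right] at this
    refine ⟨h1, ?_⟩
    have h2 := hv (x + (b j - inner ℝ (column T j) x) • e j) (mem_feasibleSet_iff.2 fun k => by
      rw [inner_add_right, inner_smul_right, he, Pi.single_apply]
      have := hx k
      split_ifs with h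
      · subst h; linarith
      · linarith)
    rw [add_sub_cancel_left, inner_smul_right] at h2
    have h3 := mul_nonneg h1 (sub_nonneg.2 (hx j))
    change -inner ℝ v (e j) * _ = 0
    linarith

/-! ### The flow field -/

/-- The multipliers `max {ρ (T_jᵀ x - b_j) + λ_j, 0}` as a vector of Euclidean space. -/
def multiplierVec (T : Matrix (Fin n) (Fin m) ℝ) (b : Fin m → ℝ) (ρ : ℝ)
    (x : EuclideanSpace ℝ (Fin n)) (lam : EuclideanSpace ℝ (Fin m)) : EuclideanSpace ℝ (Fin m) :=
  WithLp.toLp 2 (multiplier T b ρ x lam)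

theorem multiplierVec_apply (x : EuclideanSpace ℝ (Fin n)) (lam : EuclideanSpace ℝ (Fin m))
    (j : Fin m) : multiplierVec T b ρ x lam j =
      max (ρ * (inner ℝ (column T j) x - b j) + lam j) 0 := by
  simp only [multiplierVec, multiplier, transpose_mulVec_apply]

theorem primalField_eq (x : EuclideanSpace ℝ (Fin n)) (lam : EuclideanSpace ℝ (Fin m)) :
    primalField f T b ρ x lam = -gradient f x - synthesis T (multiplierVec T b ρ x lam) := by
  rw [synthesis_apply]
  rfl

theorem dualField_eq (x : EuclideanSpace ℝ (Fin n)) (lam : EuclideanSpace ℝ (Fin m)) :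
    dualField T b ρ x lam = ρ⁻¹ • (multiplierVec T b ρ x lam - lam) := by
  ext j
  simp [dualField, multiplierVec, div_eq_inv_mul]

theorem multiplierVec_eq_self (hρ : 0 < ρ) {x : EuclideanSpace ℝ (Fin n)}
    {lam : EuclideanSpace ℝ (Fin m)} (hx : x ∈ feasibleSet T b)
    (h : ∀ j, 0 ≤ lam j ∧ lam j * (inner ℝ (column T j) x - b j) = 0) :
    multiplierVec T b ρ x lam = lam := by
  ext j
  rw [multiplierVec_apply]
  rcases mul_eq_zero.1 (h j).2 with h0 | h0
  · rw [h0, add_zero, max_eq_right]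
    have := mem_feasibleSet_iff.1 hx j
    exact mul_nonpos_of_nonneg_of_nonpos hρ.le (by linarith)
  · rw [h0, mul_zero, zero_add, max_eq_left (h j).1]

theorem lipschitzWith_posPart :
    LipschitzWith 1 fun u : EuclideanSpace ℝ (Fin m) =>
      (WithLp.toLp 2 fun j => max (u j) 0 : EuclideanSpace ℝ (Fin m)) := by
  refine LipschitzWith.of_dist_le_mul fun u w => ?_
  rw [NNReal.coe_one, one_mul, EuclideanSpace.dist_eq, EuclideanSpace.dist_eq]
  refine Real.sqrt_le_sqrt (Finset.sum_le_sum fun j _ => ?_)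
  refine pow_le_pow_left₀ dist_nonneg ?_ 2
  simpa [Real.dist_eq] using abs_max_sub_max_le_abs (u j) (w j) 0

theorem exists_lipschitzWith_multiplierVec (T : Matrix (Fin n) (Fin m) ℝ) (b : Fin m → ℝ)
    (ρ : ℝ) : ∃ K, LipschitzWith K
      fun z : EuclideanSpace ℝ (Fin n) × EuclideanSpace ℝ (Fin m) =>
        multiplierVec T b ρ z.1 z.2 := by
  let L : EuclideanSpace ℝ (Fin n) × EuclideanSpace ℝ (Fin m) →L[ℝ] EuclideanSpace ℝ (Fin m) :=
    (ρ • (Matrix.toEuclideanLin Tᵀ).toContinuousLinearMap).comp (ContinuousLinearMap.fst ℝ _ _) +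
      ContinuousLinearMap.snd ℝ _ _
  have h := lipschitzWith_posPart.comp
    (L.lipschitz.sub (LipschitzWith.const (ρ • (WithLp.toLp 2 b : EuclideanSpace ℝ (Fin m)))))
  refine ⟨_, (congrArg (LipschitzWith _) (funext fun z => ?_)).mpr h⟩
  ext j
  rw [multiplierVec_apply, ← transpose_mulVec_apply]
  simp [L]
  ring_nf

theorem exists_lipschitzWith_field {K : NNReal} (hK : LipschitzWith K (gradient f)) :
    ∃ K', LipschitzWith K' fun z : EuclideanSpace ℝ (Fin n) × EuclideanSpace ℝ (Fin m) =>
      (primalField f T b ρ z.1 z.2, dualField T b ρ z.1 z.2) := by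
  obtain ⟨K₁, hK₁⟩ := exists_lipschitzWith_multiplierVec T b ρ
  have h1 := (hK.comp LipschitzWith.prod_fst).neg.sub ((synthesis T).lipschitz.comp hK₁)
  have h2 := (ρ⁻¹ • ContinuousLinearMap.id ℝ (EuclideanSpace ℝ (Fin m))).lipschitz.comp
    (hK₁.sub LipschitzWith.prod_snd)
  refine ⟨_, (congrArg (LipschitzWith _) (funext fun z => ?_)).mpr (h1.prodMk h2)⟩
  rw [primalField_eq, dualField_eq]
  rfl

theorem exists_isFlowSolution {K : NNReal} (hK : LipschitzWith K (gradient f))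
    (x₀ : EuclideanSpace ℝ (Fin n)) (lam₀ : EuclideanSpace ℝ (Fin m)) :
    ∃ (x : ℝ → EuclideanSpace ℝ (Fin n)) (lam : ℝ → EuclideanSpace ℝ (Fin m)),
      IsFlowSolution f T b ρ x lam ∧ x 0 = x₀ ∧ lam 0 = lam₀ := by
  obtain ⟨K', hK'⟩ := exists_lipschitzWith_field (T := T) (b := b) (ρ := ρ) hK
  obtain ⟨γ, h0, hγ⟩ := hK'.exists_global_solution (x₀, lam₀)
  refine ⟨fun t => (γ t).1, fun t => (γ t).2, fun t ht => ⟨?_, ?_⟩, congrArg Prod.fst h0,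
    congrArg Prod.snd h0⟩
  · exact (ContinuousLinearMap.fst ℝ _ _).hasFDerivAt.comp_hasDerivWithinAt t (hγ t ht)
  · exact (ContinuousLinearMap.snd ℝ _ _).hasFDerivAt.comp_hasDerivWithinAt t (hγ t ht)

/-! ### Dissipation along the flow -/

/-- The map `a ↦ max a 0` is firmly nonexpansive. -/
theorem mul_sub_nonneg_of_posPart (a a' : ℝ) :
    0 ≤ (max a 0 - max a' 0) * ((a - a') - (max a 0 - max a' 0)) := by
  rcases le_total a 0 with h | h <;> rcases le_total a' 0 with h' | h' <;>
    simp only [max_eq_left, max_eq_right, h, h'] <;> nlinarith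

/-- Firm nonexpansiveness of the positive part, summed over the constraints: the terms of the
energy derivative that come from the constraints are at most `-ρ ‖λ'‖²`. -/
theorem multiplierVec_dissipation (hρ : 0 < ρ) {xs : EuclideanSpace ℝ (Fin n)}
    {lams : EuclideanSpace ℝ (Fin m)} (hs : multiplierVec T b ρ xs lams = lams)
    (x : EuclideanSpace ℝ (Fin n)) (lam : EuclideanSpace ℝ (Fin m)) :
    ρ⁻¹ * ‖multiplierVec T b ρ x lam - lam‖ ^ 2 ≤
      inner ℝ (synthesis T (lam - lams + (multiplierVec T b ρ x lam - lam))) (x - xs) -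
        ρ⁻¹ * inner ℝ (lam - lams) (multiplierVec T b ρ x lam - lam) := by
  rw [inner_synthesis, EuclideanSpace.real_norm_sq_eq, PiLp.inner_apply, Finset.mul_sum,
    Finset.mul_sum, ← Finset.sum_sub_distrib]
  refine Finset.sum_le_sum fun j _ => ?_
  have hsj : lams j = max (ρ * (inner ℝ (column T j) xs - b j) + lams j) 0 := by
    rw [← multiplierVec_apply, hs]
  have key := mul_sub_nonneg_of_posPart (ρ * (inner ℝ (column T j) x - b j) + lam j)
    (ρ * (inner ℝ (column T j) xs - b j) + lams j)
  rw [← hsj, ← multiplierVec_apply] at key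
  simp only [PiLp.add_apply, PiLp.sub_apply, inner_sub_right, RCLike.inner_apply, conj_trivial]
  field_simp
  linarith

/-- The dual velocity bounds the violation of each constraint, because
`u_j - λ_j = max {ρ (T_jᵀ x - b_j), -λ_j}`. -/
theorem mul_max_sq_le_norm_multiplierVec_sub_sq (hρ : 0 < ρ) (x : EuclideanSpace ℝ (Fin n))
    (lam : EuclideanSpace ℝ (Fin m)) (j : Fin m) :
    ρ * max (inner ℝ (column T j) x - b j) 0 ^ 2 ≤
      ρ⁻¹ * ‖multiplierVec T b ρ x lam - lam‖ ^ 2 := by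
  have h1 : (ρ * max (inner ℝ (column T j) x - b j) 0) ^ 2 ≤
      (multiplierVec T b ρ x lam j - lam j) ^ 2 := by
    rcases le_total (inner ℝ (column T j) x - b j) 0 with h | h
    · rw [max_eq_right h, mul_zero, zero_pow two_ne_zero]
      positivity
    · rw [max_eq_left h, multiplierVec_apply]
      refine pow_le_pow_left₀ (by positivity) ?_ 2
      rw [le_sub_iff_add_le]
      exact le_max_left _ _
  have h2 : (multiplierVec T b ρ x lam j - lam j) ^ 2 ≤ ‖multiplierVec T b ρ x lam - lam‖ ^ 2 := by
    rw [EuclideanSpace.real_norm_sq_eq]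
    exact Finset.single_le_sum (f := fun j => ((multiplierVec T b ρ x lam - lam) j) ^ 2)
      (fun _ _ => sq_nonneg _) (Finset.mem_univ j)
  rw [inv_mul_eq_div, le_div_iff₀ hρ]
  linarith

/-- The gradient is strongly monotone on the feasible set, and the
distance to a feasible point is controlled by the monotonicity gap together with `ρ ‖λ'‖²`.
Without constraints the kernel of `Tᵀ` is the whole space; otherwise one closed half-space
suffices. -/
theorem strongly_monotone_feasibleSet_and_error_bound (hl : 0 < l) (hμ : 0 < μ) (hρ : 0 < ρ)
    (hco : ∀ x y, ‖gradient f x - gradient f y‖ ^ 2 ≤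
      l * inner ℝ (gradient f x - gradient f y) (x - y))
    (hgc : Continuous (gradient f)) (hrank : Tᵀ.rank = m)
    (hker : IsStronglyConvexIn μ f (kerTranspose T))
    (hinactive : ∀ j : Fin m, IsStronglyConvexIn μ f (inactiveHalfSpace T b j)) :
    IsStronglyConvexIn μ f (feasibleSet T b) ∧
    ∀ xs ∈ feasibleSet T b, ∃ c > 0, ∀ x lam,
      c * ‖x - xs‖ ^ 2 ≤ inner ℝ (gradient f x - gradient f xs) (x - xs) +
        ρ⁻¹ * ‖multiplierVec T b ρ x lam - lam‖ ^ 2 := by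
  rcases isEmpty_or_nonempty (Fin m) with hm | ⟨⟨j⟩⟩
  · have hmem : ∀ x, x ∈ kerTranspose T := fun x => Subsingleton.elim (α := Fin m → ℝ) _ _
    refine ⟨fun x _ y _ => hker x (hmem x) y (hmem y), fun xs _ => ⟨μ, hμ, fun x lam => ?_⟩⟩
    have h1 := hker x (hmem x) xs (hmem xs)
    have h2 : 0 ≤ ρ⁻¹ * ‖multiplierVec T b ρ x lam - lam‖ ^ 2 := by positivity
    linarith
  · have hj : ∀ x y, inner ℝ (column T j) x ≤ b j → inner ℝ (column T j) y ≤ b j →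
        μ * ‖x - y‖ ^ 2 ≤ inner ℝ (gradient f x - gradient f y) (x - y) := by
      intro x y hx hy
      refine strongly_monotone_closed_halfSpace hgc (column_ne_zero hrank j) ?_ hx hy
      intro x y hx hy
      refine hinactive j x ?_ y ?_
      · rwa [inactiveHalfSpace, Set.mem_ofPred_eq, transpose_mulVec_apply]
      · rwa [inactiveHalfSpace, Set.mem_ofPred_eq, transpose_mulVec_apply]
    refine ⟨fun x hx y hy => hj x y (mem_feasibleSet_iff.1 hx j) (mem_feasibleSet_iff.1 hy j),
      fun xs hxs => ?_⟩
    obtain ⟨c, hc, h⟩ := exists_norm_sub_sq_le_of_halfSpace hl hμ hco (column_ne_zero hrank j) hj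
      hρ (mem_feasibleSet_iff.1 hxs j)
    refine ⟨c, hc, fun x lam => (h x).trans ?_⟩
    refine add_le_add_right ?_ _
    exact mul_max_sq_le_norm_multiplierVec_sub_sq hρ x lam j

end AugPrimalDual

end

/-! ### Convergence of the flow -/

theorem mainTheorem1 {n m : ℕ} (f : EuclideanSpace ℝ (Fin n) → ℝ)
    (T : Matrix (Fin n) (Fin m) ℝ) (b : Fin m → ℝ) (l μ ρ : ℝ)
    (hl : 0 < l) (hμ : 0 < μ) (hρ : 0 < ρ)
    (hf : ContDiff ℝ 1 f)
    (hconv : ConvexOn ℝ Set.univ f)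
    (hsmooth : AugPrimalDual.IsSmoothWith l f)
    (hrank : Tᵀ.rank = m)
    (hker : AugPrimalDual.IsStronglyConvexIn μ f (AugPrimalDual.kerTranspose T))
    (hinactive : ∀ j : Fin m,
      AugPrimalDual.IsStronglyConvexIn μ f (AugPrimalDual.inactiveHalfSpace T b j)) :
    (∀ (x₀ : EuclideanSpace ℝ (Fin n)) (lam₀ : EuclideanSpace ℝ (Fin m)),
      ∃ (x : ℝ → EuclideanSpace ℝ (Fin n)) (lam : ℝ → EuclideanSpace ℝ (Fin m)),
        AugPrimalDual.IsFlowSolution f T b ρ x lam ∧ x 0 = x₀ ∧ lam 0 = lam₀) ∧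
    ∃ xs : EuclideanSpace ℝ (Fin n),
      AugPrimalDual.IsOptimal f T b xs ∧
      (∀ y, AugPrimalDual.IsOptimal f T b y → y = xs) ∧
      ∃ lams : EuclideanSpace ℝ (Fin m),
        AugPrimalDual.IsEquilibrium f T b ρ xs lams ∧
        ∃ C α : ℝ, 0 < C ∧ 0 < α ∧
          ∀ (x : ℝ → EuclideanSpace ℝ (Fin n)) (lam : ℝ → EuclideanSpace ℝ (Fin m)),
            AugPrimalDual.IsFlowSolution f T b ρ x lam →
            ∀ t : ℝ, 0 ≤ t →
              ‖x t - xs‖ ≤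
                C * Real.exp (-α * t) * Real.sqrt (‖x 0 - xs‖ ^ 2 + ‖lam 0 - lams‖ ^ 2) := by
  have hg : ∀ x, HasGradientAt f (gradient f x) x := fun x =>
    (hf.differentiable one_ne_zero x).hasGradientAt
  have hco := hconv.norm_gradient_sub_sq_le hg hl hsmooth
  have hlip : LipschitzWith l.toNNReal (gradient f) := LipschitzWith.of_dist_le' fun x y => by
    rw [dist_eq_norm, dist_eq_norm]
    exact norm_sub_le_mul_norm_sub_of_cocoercive hl hco x y
  refine ⟨AugPrimalDual.exists_isFlowSolution hlip, ?_⟩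
  obtain ⟨hmono, herr⟩ := AugPrimalDual.strongly_monotone_feasibleSet_and_error_bound hl hμ hρ hco
    hlip.continuous hrank hker hinactive
  have hne : (AugPrimalDual.feasibleSet T b).Nonempty := by
    obtain ⟨x, hx⟩ := AugPrimalDual.exists_inner_column_eq hrank b
    exact ⟨x, AugPrimalDual.mem_feasibleSet_iff.2 fun j => (hx j).le⟩
  obtain ⟨xs, hxs, hmin⟩ := hconv.exists_isMinOn_of_strongly_monotone hg
    AugPrimalDual.convex_feasibleSet AugPrimalDual.isClosed_feasibleSet hne hμ hmono
  have hopt : AugPrimalDual.IsOptimal f T b xs := ⟨hxs, hmin⟩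
  have hvar : ∀ y ∈ AugPrimalDual.feasibleSet T b, 0 ≤ inner ℝ (gradient f xs) (y - xs) :=
    fun y hy => hopt.inner_gradient_nonneg (hg xs) hy
  refine ⟨xs, hopt, fun y hy => ?_, ?_⟩
  · have h1 := hconv.quadratic_growth hg AugPrimalDual.convex_feasibleSet hmono hxs hy.1
    have h2 := hy.2 xs hxs
    have h3 := hvar y hy.1
    have h4 : μ / 4 * ‖y - xs‖ ^ 2 ≤ 0 := by linarith
    have h5 : ‖y - xs‖ ^ 2 ≤ 0 := nonpos_of_mul_nonpos_right h4 (by positivity)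
    have h6 : ‖y - xs‖ = 0 := by simpa using le_antisymm h5 (sq_nonneg _)
    exact sub_eq_zero.1 (norm_eq_zero.1 h6)
  obtain ⟨lams, hstat, hcomp⟩ := AugPrimalDual.exists_kkt_multiplier hrank hxs hvar
  have hfix := AugPrimalDual.multiplierVec_eq_self hρ hxs hcomp
  refine ⟨lams, ⟨?_, ?_⟩, ?_⟩
  · rw [AugPrimalDual.primalField_eq, hfix, ← neg_add', hstat, neg_zero]
  · rw [AugPrimalDual.dualField_eq, hfix, sub_self, smul_zero]
  obtain ⟨σ, hσ, hA⟩ := AugPrimalDual.exists_mul_norm_sq_le_norm_synthesis_sq hrank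
  obtain ⟨c, hc, hbound⟩ := herr xs hxs
  obtain ⟨C, α, hC, hα, hdecay⟩ :=
    exists_exponential_decay (AugPrimalDual.synthesis T) hσ hρ hl hc hA
  refine ⟨C, α, hC, hα, fun x lam hsol => ?_⟩
  refine hdecay (fun t => x t - xs) (fun t => gradient f (x t) - gradient f xs)
    (fun t => lam t - lams) (fun t => AugPrimalDual.multiplierVec T b ρ (x t) (lam t) - lam t)
    ?_ ?_ (fun t _ => hco _ _)
    (fun t _ => AugPrimalDual.multiplierVec_dissipation hρ hfix _ _) (fun t _ => hbound _ _)
  · intro t ht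
    refine ((hsol t ht).1.sub_const xs).congr_deriv ?_
    rw [AugPrimalDual.primalField_eq, sub_add_sub_cancel', map_sub,
      eq_neg_of_add_eq_zero_left hstat]
    abel
  · intro t ht
    refine ((hsol t ht).2.sub_const lams).congr_deriv ?_
    rw [AugPrimalDual.dualField_eq]
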